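/- Let $M$ be a smooth $3$-manifold (without boundary) and let $X$ be a nowhere vanishing $C^1$ vector field on $M$ generating a flow $\phi^t$, $t\in\mathbb{R}$. A *Birkhoff section* for the flow is a $C^1$ immersion $\iota:S\to M$ of a compact smooth surface $S$ with (possibly empty) boundary such that: (1) $\iota(\partial S)$ is a union of periodic orbits of $X$; (2) $\iota^{-1}(\iota(\partial S))=\partial S$, and $\iota|_{S\setminus\partial S}:S\setminus\partial S\to M\setminus\iota(\partial S)$ is an embedding transverse to $X$; (3) for every $p\in M$ there are $t_-<0<t_+$ with $\phi^{t_\pm}(p)\in\iota(S)$. Write $\mathbb{T}^2=\mathbb{R}^2/\mathbb{Z}^2$. Let $T_s$, $s\in(a,b)$, be a family of invariant tori on which the flow is conjugate to a linear motion. That is, there is a continuous map $F:(a,b)\times\mathbb{T}^2\to M$ such that, for each $s$, the map $F_s=F(s,\cdot)$ is injective with image $T_s$, and there are a homeomorphism $h_s$ of $\mathbb{T}^2$ homotopic to the identity and a vector $v_s\in\mathbb{R}^2$ with $$\phi^t\bigl(F_s(h_s(x))\bigr)=F_s\bigl(h_s(x+tv_s)\bigr)\qquad\text{for all } t\in\mathbb{R},\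 x\in\mathbb{T}^2 .$$ Suppose that the direction of the linear flow passes through every point of the projective line: for every $\ell\in\mathbb{RP}^1$ there is $s\in(a,b)$ with $v_s\neq0$ and $[v_s]=\ell$. Then every Birkhoff section $\iota:S\to M$ satisfies $$\iota(\partial S)\cap\bigcup_{s\in(a,b)}T_s\neq\emptyset .$$ In particular (as $\iota(\partial S)$ is a union of periodic orbits and each $T_s$ is invariant), $\iota$ has a boundary orbit contained in one of the tori $T_s$. -/

import Mathlib

open Set Function
open scoped Manifold ContDiff

namespace BirkhoffTori

section Dynamics

variable {M : Type*} [TopologicalSpace M]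

/-- `P` is a periodic orbit of the flow `φ`: the full orbit of a point that returns to itself
after some positive time. -/
def IsPeriodicOrbit (φ : Flow ℝ M) (P : Set M) : Prop :=
  ∃ p : M, (∃ T : ℝ, 0 < T ∧ φ T p = p) ∧ P = range (fun t : ℝ => φ t p)

/-- The standard torus `(ℝ/ℤ) × (ℝ/ℤ)`; the two circle factors give the two standard generators of
its first homology group. -/
abbrev Torus : Type := UnitAddCircle × UnitAddCircle

/-- The linear motion `x ↦ x + t v` on the standard torus, with velocity vector `v ∈ ℝ²`. -/
def linearMotion (v : ℝ × ℝ) (t : ℝ) (x : Torus) : Torus :=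
  x + (((t * v.1 : ℝ) : UnitAddCircle), ((t * v.2 : ℝ) : UnitAddCircle))

/-- A family of invariant tori `T_s`, `s ∈ (a, b)`, of the flow `φ`, on each of which the flow is
conjugate to a linear motion.

The map `param` parametrizes the family: it is continuous in `(s, x)` and for each `s` it is
injective on the torus, hence a homeomorphism onto `T_s` when `M` is Hausdorff. In particular it
identifies the first homology groups of all the tori `T_s` with `ℤ²`, consistently in `s`.
The flow on `T_s` is conjugate, by a homeomorphism compatible with this identification
(that is, homotopic to the identity in the coordinates `param s`, but in no way assumed to depend
continuously on `s`), to the linear motion with velocity `velocity s`. The values of `param` and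
`velocity` outside `(a, b)` are irrelevant. -/
structure InvariantTorusFamily (φ : Flow ℝ M) (a b : ℝ) where
  param : ℝ → Torus → M
  continuousOn_param :
    ContinuousOn (fun z : ℝ × Torus => param z.1 z.2) (Ioo a b ×ˢ (univ : Set Torus))
  injective_param : ∀ s ∈ Ioo a b, Injective (param s)
  velocity : ℝ → ℝ × ℝ
  conj_linear : ∀ s ∈ Ioo a b, ∃ h : Torus ≃ₜ Torus,
    ContinuousMap.Homotopic (h : C(Torus, Torus)) (ContinuousMap.id Torus) ∧
      ∀ (t : ℝ) (x : Torus),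
        φ t (param s (h x)) = param s (h (linearMotion (velocity s) t x))

namespace InvariantTorusFamily

variable {φ : Flow ℝ M} {a b : ℝ}

/-- The torus `T_s` of the family. -/
def torus (F : InvariantTorusFamily φ a b) (s : ℝ) : Set M := range (F.param s)

/-- The direction of the linear flow passes through every point of the real projective line as the
torus ranges over the family. -/
def CoversAllDirections (F : InvariantTorusFamily φ a b) : Prop :=
  ∀ l : Projectivization ℝ (ℝ × ℝ), ∃ s ∈ Ioo a b, ∃ hv : F.velocity s ≠ 0,
    Projectivization.mk ℝ (F.velocity s) hv = l

end InvariantTorusFamily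

end Dynamics

section Sections

variable {M : Type*} [TopologicalSpace M] [ChartedSpace (EuclideanSpace ℝ (Fin 3)) M]
  [IsManifold (𝓡 3) ∞ M]

/-- The vector field `X` on the 3-manifold `M` is of class `C¹`. -/
def IsC1VectorField (X : (p : M) → TangentSpace (𝓡 3) p) : Prop :=
  ContMDiff (𝓡 3) (𝓡 3).tangent 1 (fun p => (⟨p, X p⟩ : TangentBundle (𝓡 3) M))

/-- `φ` is the flow generated by the vector field `X`. -/
def IsFlowOf (φ : Flow ℝ M) (X : (p : M) → TangentSpace (𝓡 3) p) : Prop :=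
  ∀ p : M, IsMIntegralCurve (I := 𝓡 3) (fun t : ℝ => φ t p) X

/-- The map `ι : S → M`, defined on a compact surface `S` with (possibly empty) boundary, is a
Birkhoff section for the flow `φ` of the vector field `X`. -/
structure IsBirkhoffSection (X : (p : M) → TangentSpace (𝓡 3) p) (φ : Flow ℝ M)
    {S : Type*} [TopologicalSpace S] [T2Space S] [CompactSpace S]
    [ChartedSpace (EuclideanHalfSpace 2) S] [IsManifold (𝓡∂ 2) ∞ S] (ι : S → M) : Prop where
  /-- `ι` is an immersion of class `C¹` ... -/
  contMDiff : ContMDiff (𝓡∂ 2) (𝓡 3) 1 ι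
  injective_mfderiv : ∀ y : S, Injective (mfderiv (𝓡∂ 2) (𝓡 3) ι y)
  /-- `ι(∂S)` consists of periodic orbits -/
  boundary_orbits : ∀ p ∈ ι '' (𝓡∂ 2).boundary S,
    ∃ P : Set M, IsPeriodicOrbit φ P ∧ p ∈ P ∧ P ⊆ ι '' (𝓡∂ 2).boundary S
  /-- only boundary points of `S` are mapped into `ι(∂S)` -/
  preimage_boundary : ι ⁻¹' (ι '' (𝓡∂ 2).boundary S) = (𝓡∂ 2).boundary S
  /-- the immersion `ι` restricts to an embedding of `S \ ∂S` ... -/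
  isEmbedding_interior :
    Topology.IsEmbedding (fun y : {y : S // y ∉ (𝓡∂ 2).boundary S} => ι y)
  /-- ... which is transverse to `X` -/
  transverse : ∀ y : S, y ∉ (𝓡∂ 2).boundary S →
    X (ι y) ∉ range (mfderiv (𝓡∂ 2) (𝓡 3) ι y)
  /-- every flow line hits `ι(S)` both in the future and in the past -/
  hits : ∀ p : M, (∃ t : ℝ, t < 0 ∧ φ t p ∈ range ι) ∧ (∃ t : ℝ, 0 < t ∧ φ t p ∈ range ι)

end Sections

end BirkhoffTori

/-! Suppose the boundary orbits miss every torus of the family. Off the boundary orbits, the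
fraction of time elapsed between consecutive crossings of `ι(S)` is a continuous circle-valued
function, the `phase`. Each crossing-to-crossing segment adds exactly `1` to a real lift of it, so
along an orbit that avoids the boundary every lift is unbounded (`not_bounded_lift_phase`).

On the tori the phase has a cohomology class `(m, n)`, the same for all `s` by homotopy invariance.
Since all directions occur, some `v_s` lies in the kernel of `(m, n)`. A lift to the plane is the
linear form `(m, n)` plus a doubly periodic, hence bounded, function, so it stays bounded along the
lines of direction `v_s` (`exists_bounded_lift`). This is a contradiction.

Continuity of the phase rests on transversality: an orbit near an interior point of the section
crosses it exactly once in a short time (`eventually_existsUnique_crossing`). -/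

namespace BirkhoffTori

open Filter Topology

set_option linter.unusedSectionVars false

/-! ### Straightening a hypersurface along a transverse vector -/

section TransverseCoordinate

variable {E F : Type*} [NormedAddCommGroup E] [NormedSpace ℝ E] [FiniteDimensional ℝ E]
  [NormedAddCommGroup F] [NormedSpace ℝ F] [FiniteDimensional ℝ F]

/-- A hypersurface parametrized by a `C¹` immersion is locally the zero set of a `C¹` function with
prescribed derivative `1` along a given transverse vector. -/
theorem exists_transverse_coordinate (hdim : Module.finrank ℝ F = Module.finrank ℝ E + 1)
    {g : E → F} {u₀ : E} (hg : ContDiffAt ℝ 1 g u₀) (hinj : Injective (fderiv ℝ g u₀))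
    {w : F} (hw : w ∉ range (fderiv ℝ g u₀)) :
    ∃ f : F → ℝ, ContDiffAt ℝ 1 f (g u₀) ∧ fderiv ℝ f (g u₀) w = 1 ∧
      (∀ᶠ u in 𝓝 u₀, f (g u) = 0) ∧
      ∀ U ∈ 𝓝 u₀, ∀ᶠ x in 𝓝 (g u₀), f x = 0 → ∃ u ∈ U, g u = x := by
  have : CompleteSpace E := FiniteDimensional.complete ℝ E
  -- Thicken the hypersurface in the direction `w`. Transversality and the dimension count make the
  -- derivative invertible; `f` is the last coordinate of the local inverse.
  let Φ : E × ℝ → F := fun z => g z.1 + z.2 • w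
  have hΦ₀ : Φ (u₀, 0) = g u₀ := by simp [Φ]
  have hΦ : ContDiffAt ℝ 1 Φ (u₀, 0) :=
    (ContDiffAt.comp (u₀, (0 : ℝ)) hg contDiffAt_fst).add (contDiffAt_snd.smul contDiffAt_const)
  let L : E × ℝ →L[ℝ] F :=
    (fderiv ℝ g u₀).comp (ContinuousLinearMap.fst ℝ E ℝ) +
      (ContinuousLinearMap.snd ℝ E ℝ).smulRight w
  have hL : HasFDerivAt Φ L (u₀, 0) := by
    have h1 : HasFDerivAt (fun z : E × ℝ => g z.1)
        ((fderiv ℝ g u₀).comp (ContinuousLinearMap.fst ℝ E ℝ)) (u₀, 0) :=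
      HasFDerivAt.comp (u₀, (0 : ℝ)) (hg.differentiableAt one_ne_zero).hasFDerivAt hasFDerivAt_fst
    exact h1.add (hasFDerivAt_snd.smul_const w)
  have hLinj : Injective L := by
    rw [injective_iff_map_eq_zero]
    rintro ⟨u, r⟩ h
    have h' : fderiv ℝ g u₀ u + r • w = 0 := h
    have hr : r = 0 := by
      by_contra hr
      refine hw ⟨-(r⁻¹ • u), ?_⟩
      rw [map_neg, map_smul, eq_neg_of_add_eq_zero_left h', smul_neg, neg_neg, smul_smul,
        inv_mul_cancel₀ hr, one_smul]
    subst hr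
    have hu : u = 0 := hinj (by simpa using h')
    simp [hu]
  let e : (E × ℝ) ≃L[ℝ] F := (LinearEquiv.ofInjectiveOfFinrankEq (L : E × ℝ →ₗ[ℝ] F) hLinj
    (by simp [hdim])).toContinuousLinearEquiv
  have he : HasFDerivAt Φ (e : E × ℝ →L[ℝ] F) (u₀, 0) := by
    convert hL using 1
    ext z <;> rfl
  have hs := hΦ.hasStrictFDerivAt' he one_ne_zero
  set Ψ := hΦ.localInverse he one_ne_zero with hΨdef
  have hΨ : ContDiffAt ℝ 1 Ψ (g u₀) := hΦ₀ ▸ hΦ.to_localInverse he one_ne_zero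
  have hΨ₀ : Ψ (g u₀) = (u₀, 0) := by
    have := hΦ.localInverse_apply_image he one_ne_zero
    rwa [hΦ₀] at this
  have hleft : ∀ᶠ z in 𝓝 (u₀, (0 : ℝ)), Ψ (Φ z) = z := hs.eventually_left_inverse
  have hright : ∀ᶠ x in 𝓝 (g u₀), Φ (Ψ x) = x := hΦ₀ ▸ hs.eventually_right_inverse
  have hΨ' : HasFDerivAt Ψ (e.symm : F →L[ℝ] E × ℝ) (g u₀) :=
    hΦ₀ ▸ hs.to_localInverse.hasFDerivAt
  have hew : e.symm w = (0, 1) := by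
    rw [ContinuousLinearEquiv.symm_apply_eq]
    change w = fderiv ℝ g u₀ 0 + (1 : ℝ) • w
    simp
  refine ⟨fun x => (Ψ x).2, contDiffAt_snd.comp _ hΨ, ?_, ?_, ?_⟩
  · have : HasFDerivAt (fun x => (Ψ x).2)
        ((ContinuousLinearMap.snd ℝ E ℝ).comp (e.symm : F →L[ℝ] E × ℝ)) (g u₀) :=
      HasFDerivAt.comp (g u₀) hasFDerivAt_snd hΨ'
    rw [this.fderiv]
    simp [hew]
  · have hc : Tendsto (fun u : E => (u, (0 : ℝ))) (𝓝 u₀) (𝓝 (u₀, 0)) :=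
      (Continuous.prodMk_left (0 : ℝ)).tendsto u₀
    filter_upwards [hc.eventually hleft] with u hu
    have : Φ (u, 0) = g u := by simp [Φ]
    rw [this] at hu
    simp [hu]
  · intro U hU
    have hc : Tendsto (fun x => (Ψ x).1) (𝓝 (g u₀)) (𝓝 u₀) := by
      have := hΨ.continuousAt.fst
      simpa [ContinuousAt, hΨ₀] using this
    filter_upwards [hright, hc.eventually hU] with x hx hxU h0
    refine ⟨(Ψ x).1, hxU, ?_⟩
    have h1 : g (Ψ x).1 + (Ψ x).2 • w = x := hx
    simpa [h0] using h1

end TransverseCoordinate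

/-! ### Local crossings of the section -/

section FlowBox

variable {M : Type*} [TopologicalSpace M] [T2Space M]
  [ChartedSpace (EuclideanSpace ℝ (Fin 3)) M] [IsManifold (𝓡 3) ∞ M]
  {X : (p : M) → TangentSpace (𝓡 3) p} {φ : Flow ℝ M}
  {S : Type*} [TopologicalSpace S] [T2Space S] [CompactSpace S]
  [ChartedSpace (EuclideanHalfSpace 2) S] [IsManifold (𝓡∂ 2) ∞ S] {ι : S → M}

theorem IsBirkhoffSection.notMem_image_boundary (hι : IsBirkhoffSection X φ ι) {y : S}
    (hy : y ∉ (𝓡∂ 2).boundary S) : ι y ∉ ι '' (𝓡∂ 2).boundary S := by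
  intro h
  rw [← mem_preimage, hι.preimage_boundary] at h
  exact hy h

theorem IsBirkhoffSection.eq_of_apply_eq (hι : IsBirkhoffSection X φ ι) {y y' : S}
    (hy : y ∉ (𝓡∂ 2).boundary S) (h : ι y' = ι y) : y' = y := by
  have hy' : y' ∉ (𝓡∂ 2).boundary S := fun hb =>
    hι.notMem_image_boundary hy ⟨y', hb, h⟩
  exact congrArg Subtype.val (@hι.isEmbedding_interior.injective ⟨y', hy'⟩ ⟨y, hy⟩ h)

/-- By compactness of `S`, no other sheet of `ι(S)` accumulates at `ι y`; a local equation for the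
sheet through `y` therefore describes all of `range ι` nearby. -/
theorem IsBirkhoffSection.eventually_preimage_subset (hι : IsBirkhoffSection X φ ι) {y : S}
    (hy : y ∉ (𝓡∂ 2).boundary S) {V : Set S} (hV : V ∈ 𝓝 y) :
    ∀ᶠ p in 𝓝 (ι y), ∀ y', ι y' = p → y' ∈ V := by
  have hK : IsCompact (ι '' (interior V)ᶜ) :=
    (isOpen_interior.isClosed_compl.isCompact).image hι.contMDiff.continuous
  have hn : ι y ∉ ι '' (interior V)ᶜ := by
    rintro ⟨y', hy', h⟩
    exact hy' (hι.eq_of_apply_eq hy h ▸ mem_interior_iff_mem_nhds.2 hV)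
  filter_upwards [hK.isClosed.isOpen_compl.mem_nhds hn] with p hp y' h
  by_contra hc
  exact hp ⟨y', fun h' => hc (interior_subset h'), h⟩

/-- Near an interior point, a Birkhoff section is the zero set of a `C¹` function whose derivative
along the vector field is nonzero. -/
theorem IsBirkhoffSection.exists_local_equation (hι : IsBirkhoffSection X φ ι) {y : S}
    (hy : y ∉ (𝓡∂ 2).boundary S) :
    ∃ f : M → ℝ, ContMDiffAt (𝓡 3) 𝓘(ℝ, ℝ) 1 f (ι y) ∧
      mfderiv (𝓡 3) 𝓘(ℝ, ℝ) f (ι y) (X (ι y)) = (1 : ℝ) ∧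
      ∀ᶠ p in 𝓝 (ι y), f p = 0 ↔ p ∈ range ι := by
  have hint : range (𝓡∂ 2) ∈ 𝓝 (extChartAt (𝓡∂ 2) y y) := by
    apply range_mem_nhds_isInteriorPoint
    exact (ModelWithCorners.isInteriorPoint_iff_not_isBoundaryPoint y).2 hy
  set u₀ := extChartAt (𝓡∂ 2) y y with hu₀
  set g := writtenInExtChartAt (𝓡∂ 2) (𝓡 3) y ι with hgdef
  have hgu₀ : g u₀ = extChartAt (𝓡 3) (ι y) (ι y) := by
    change extChartAt (𝓡 3) (ι y)
      (ι ((extChartAt (𝓡∂ 2) y).symm (extChartAt (𝓡∂ 2) y y))) = _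
    rw [extChartAt_to_inv]
  have hcd : ContMDiffAt (𝓡∂ 2) (𝓡 3) 1 ι y := hι.contMDiff y
  have hg : ContDiffAt ℝ 1 g u₀ := (contMDiffAt_iff.1 hcd).2.contDiffAt hint
  have hdg : mfderiv (𝓡∂ 2) (𝓡 3) ι y = fderiv ℝ g u₀ := by
    rw [(hcd.mdifferentiableAt one_ne_zero).mfderiv, fderivWithin_of_mem_nhds hint]
  obtain ⟨f, hf, hfw, hf0, hfU⟩ := exists_transverse_coordinate
    (E := EuclideanSpace ℝ (Fin 2)) (F := EuclideanSpace ℝ (Fin 3)) (by simp) hg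
    (by have := hι.injective_mfderiv y; rwa [hdg] at this)
    (w := X (ι y)) (by have := hι.transverse y hy; rwa [hdg] at this)
  rw [hgu₀] at hf hfw hfU
  refine ⟨f ∘ extChartAt (𝓡 3) (ι y), ?_, ?_, ?_⟩
  · exact ContMDiffAt.comp (ι y) hf.contMDiffAt contMDiffAt_extChartAt
  · have hm : ContMDiffAt (𝓡 3) 𝓘(ℝ, ℝ) 1 (f ∘ extChartAt (𝓡 3) (ι y)) (ι y) :=
      ContMDiffAt.comp (ι y) hf.contMDiffAt contMDiffAt_extChartAt
    rw [(hm.mdifferentiableAt one_ne_zero).mfderiv]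
    have : writtenInExtChartAt (𝓡 3) 𝓘(ℝ, ℝ) (ι y) (f ∘ extChartAt (𝓡 3) (ι y))
        =ᶠ[𝓝 (extChartAt (𝓡 3) (ι y) (ι y))] f := by
      filter_upwards [extChartAt_target_mem_nhds (I := 𝓡 3) (ι y)] with x hx
      change f (extChartAt (𝓡 3) (ι y) ((extChartAt (𝓡 3) (ι y)).symm x)) = f x
      rw [(extChartAt (𝓡 3) (ι y)).right_inv hx]
    rw [fderivWithin_of_mem_nhds (by simp), this.fderiv_eq]
    exact hfw
  · have hsrc := extChartAt_source_mem_nhds (I := 𝓡 3) (ι y)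
    have hU : {u | u ∈ (extChartAt (𝓡∂ 2) y).target ∧
        ι ((extChartAt (𝓡∂ 2) y).symm u) ∈ (extChartAt (𝓡 3) (ι y)).source} ∈ 𝓝 u₀ := by
      have h1 : (extChartAt (𝓡∂ 2) y).target ∈ 𝓝 u₀ := by
        have := extChartAt_target_mem_nhdsWithin (I := 𝓡∂ 2) y
        rwa [nhdsWithin_eq_nhds.2 hint] at this
      have h2 : ContinuousAt (extChartAt (𝓡∂ 2) y).symm u₀ := continuousAt_extChartAt_symm y
      have h3 : ContinuousAt (fun u => ι ((extChartAt (𝓡∂ 2) y).symm u)) u₀ :=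
        hι.contMDiff.continuous.continuousAt.comp h2
      refine inter_mem h1 (h3.preimage_mem_nhds ?_)
      change (extChartAt (𝓡 3) (ι y)).source ∈
        𝓝 (ι ((extChartAt (𝓡∂ 2) y).symm (extChartAt (𝓡∂ 2) y y)))
      rwa [extChartAt_to_inv]
    have hV : {y' | y' ∈ (extChartAt (𝓡∂ 2) y).source ∧ f (g (extChartAt (𝓡∂ 2) y y')) = 0}
        ∈ 𝓝 y :=
      inter_mem (extChartAt_source_mem_nhds y) ((continuousAt_extChartAt y).eventually hf0)
    filter_upwards [hsrc, (continuousAt_extChartAt (I := 𝓡 3) (ι y)).eventually (hfU _ hU),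
      hι.eventually_preimage_subset hy hV] with p hp h1 h2
    constructor
    · intro h
      obtain ⟨u, ⟨-, hu⟩, hup⟩ := h1 h
      exact ⟨_, (extChartAt (𝓡 3) (ι y)).injOn hu hp hup⟩
    · rintro ⟨y', rfl⟩
      obtain ⟨h3, h4⟩ := h2 y' rfl
      change f (extChartAt (𝓡 3) (ι y)
        (ι ((extChartAt (𝓡∂ 2) y).symm (extChartAt (𝓡∂ 2) y y')))) = 0 at h4
      rwa [(extChartAt (𝓡∂ 2) y).left_inv h3] at h4

theorem eventually_mfderiv_pos (hX : IsC1VectorField X) {f : M → ℝ} {q : M}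
    (hf : ContMDiffAt (𝓡 3) 𝓘(ℝ, ℝ) 1 f q)
    (hpos : (0 : ℝ) < mfderiv (𝓡 3) 𝓘(ℝ, ℝ) f q (X q)) :
    ∀ᶠ p in 𝓝 q, MDifferentiableAt (𝓡 3) 𝓘(ℝ, ℝ) f p ∧
      (0 : ℝ) < mfderiv (𝓡 3) 𝓘(ℝ, ℝ) f p (X p) := by
  have hev := (contMDiffAt_iff_contMDiffAt_nhds (by simp)).1 hf
  obtain ⟨U, hU, hUo, hqU⟩ := eventually_nhds_iff.1 hev
  have hfU : ContMDiffOn (𝓡 3) 𝓘(ℝ, ℝ) 1 f U := fun p hp => (hU p hp).contMDiffWithinAt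
  have hT := hfU.continuousOn_tangentMapWithin le_rfl hUo.uniqueMDiffOn
  have hXc : Continuous (fun p => (⟨p, X p⟩ : TangentBundle (𝓡 3) M)) := hX.continuous
  have hcomp : ContinuousOn (fun p => tangentMapWithin (𝓡 3) 𝓘(ℝ, ℝ) f U ⟨p, X p⟩) U :=
    hT.comp hXc.continuousOn (fun p hp => hp)
  have hsnd : ContinuousOn (fun p => (tangentBundleModelSpaceHomeomorph 𝓘(ℝ, ℝ)
      (tangentMapWithin (𝓡 3) 𝓘(ℝ, ℝ) f U ⟨p, X p⟩)).2) U :=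
    (continuous_snd.comp (Homeomorph.continuous _)).comp_continuousOn hcomp
  have hval : ∀ p ∈ U, (tangentBundleModelSpaceHomeomorph 𝓘(ℝ, ℝ)
      (tangentMapWithin (𝓡 3) 𝓘(ℝ, ℝ) f U ⟨p, X p⟩)).2 =
        mfderiv (𝓡 3) 𝓘(ℝ, ℝ) f p (X p) := by
    intro p hp
    simp only [tangentMapWithin, mfderivWithin_of_isOpen hUo hp]
    rfl
  have h1 := (hsnd.continuousAt (hUo.mem_nhds hqU)).eventually_const_lt
    (hpos.trans_eq (hval q hqU).symm)
  filter_upwards [h1, hUo.mem_nhds hqU] with p hp hpU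
  rw [hval p hpU] at hp
  exact ⟨(hU p hpU).mdifferentiableAt one_ne_zero, hp⟩

/-- Near an interior point, a Birkhoff section is crossed exactly once in a short time. -/
theorem IsBirkhoffSection.eventually_existsUnique_crossing (hι : IsBirkhoffSection X φ ι)
    (hX : IsC1VectorField X) (hφ : IsFlowOf φ X) {y : S} (hy : y ∉ (𝓡∂ 2).boundary S) :
    ∃ ε₀ > 0, ∀ ε, 0 < ε → ε ≤ ε₀ →
      ∀ᶠ p in 𝓝 (ι y), ∃! t : ℝ, t ∈ Icc (-ε) ε ∧ φ t p ∈ range ι := by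
  obtain ⟨f, hf, hf1, hf0⟩ := hι.exists_local_equation hy
  have hgood := (eventually_mfderiv_pos hX hf (by rw [hf1]; exact one_pos)).and hf0
  set q := ι y with hq
  obtain ⟨U, hU, hUo, hqU⟩ := eventually_nhds_iff.1 hgood
  have hcurve : Continuous (fun t : ℝ => φ t q) := φ.continuous continuous_id continuous_const
  have hc0 : (fun t : ℝ => φ t q) ⁻¹' U ∈ 𝓝 (0 : ℝ) :=
    hcurve.continuousAt.preimage_mem_nhds (by simpa using hUo.mem_nhds hqU)
  obtain ⟨δ, hδ, hball⟩ := Metric.mem_nhds_iff.1 hc0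
  refine ⟨δ / 2, by positivity, fun ε hε hεδ => ?_⟩
  have hqt : ∀ t ∈ Icc (-ε) ε, φ t q ∈ U := fun t ht => hball (by
    rw [Metric.mem_ball, Real.dist_eq, sub_zero, abs_lt]
    constructor <;> linarith [ht.1, ht.2])
  -- The local equation `f` increases strictly along orbit segments inside `U`, which gives
  -- uniqueness. Existence follows from the intermediate value theorem, the signs of `f` at times
  -- `-ε` and `ε` persisting from `q` to nearby points.
  have hmono : ∀ p, (∀ t ∈ Icc (-ε) ε, φ t p ∈ U) →
      ContinuousOn (fun t => f (φ t p)) (Icc (-ε) ε) ∧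
      StrictMonoOn (fun t => f (φ t p)) (Icc (-ε) ε) := by
    intro p hp
    have hder : ∀ t ∈ Icc (-ε) ε, HasDerivAt (fun t => f (φ t p))
        (mfderiv (𝓡 3) 𝓘(ℝ, ℝ) f (φ t p) (X (φ t p))) t := by
      intro t ht
      let A : EuclideanSpace ℝ (Fin 3) →L[ℝ] ℝ := mfderiv (𝓡 3) 𝓘(ℝ, ℝ) f (φ t p)
      let v : EuclideanSpace ℝ (Fin 3) := X (φ t p)
      have h : HasFDerivAt (fun t => f (φ t p)) (A.comp ((1 : ℝ →L[ℝ] ℝ).smulRight v)) t :=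
        (HasMFDerivAt.comp t (hU _ (hp t ht)).1.1.hasMFDerivAt (hφ p t)).hasFDerivAt
      have hA : (A.comp ((1 : ℝ →L[ℝ] ℝ).smulRight v)) 1 = A v := by simp
      exact hA ▸ h.hasDerivAt
    have hcont : ContinuousOn (fun t => f (φ t p)) (Icc (-ε) ε) :=
      fun t ht => (hder t ht).continuousAt.continuousWithinAt
    refine ⟨hcont, strictMonoOn_of_deriv_pos (convex_Icc _ _) hcont fun t ht => ?_⟩
    have ht' := interior_subset ht
    rw [(hder t ht').deriv]
    exact (hU _ (hp t ht')).1.2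
  have htube : ∀ᶠ p in 𝓝 q, ∀ t ∈ Icc (-ε) ε, φ t p ∈ U := by
    refine isCompact_Icc.eventually_forall_of_forall_eventually fun t ht => ?_
    have : Continuous (fun z : M × ℝ => φ z.2 z.1) := φ.continuous continuous_snd continuous_fst
    exact this.continuousAt.preimage_mem_nhds (hUo.mem_nhds (hqt t ht))
  obtain ⟨-, hmq⟩ := hmono q hqt
  have hl : -ε ∈ Icc (-ε) ε := by constructor <;> linarith
  have hr : ε ∈ Icc (-ε) ε := by constructor <;> linarith
  have hz : (0 : ℝ) ∈ Icc (-ε) ε := by constructor <;> linarith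
  have hfq : f (φ 0 q) = 0 := by simpa using ((hU q hqU).2).2 ⟨y, rfl⟩
  have hneg : f (φ (-ε) q) < 0 := (hmq hl hz (by linarith)).trans_eq hfq
  have hpos : 0 < f (φ ε q) := hfq.symm.trans_lt (hmq hz hr hε)
  have hev : ∀ t ∈ Icc (-ε) ε, ContinuousAt (fun p => f (φ t p)) q := fun t ht =>
    ContinuousAt.comp (g := f) (f := fun p => φ t p) (hU _ (hqt t ht)).1.1.continuousAt
      (φ.continuous_toFun t).continuousAt
  filter_upwards [htube, (hev _ hl).eventually (gt_mem_nhds hneg),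
    (hev _ hr).eventually (lt_mem_nhds hpos)] with p hp hpl hpr
  obtain ⟨hcp, hmp⟩ := hmono p hp
  obtain ⟨t, ht, ht0⟩ := intermediate_value_Icc (by linarith) hcp ⟨hpl.le, hpr.le⟩
  refine ⟨t, ⟨ht, (hU _ (hp t ht)).2.1 ht0⟩, fun t' ⟨ht', hr'⟩ => hmp.injOn ht' ht ?_⟩
  refine Eq.trans ?_ ht0.symm
  exact (hU _ (hp t' ht')).2.2 hr'

end FlowBox

/-! ### Hitting times and the phase function -/

section Phase

/-- A continuous function on a preconnected set with integer values is constant. -/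
theorem eq_of_coe_unitAddCircle_eq_zero {A : Type*} [TopologicalSpace A] {s : Set A}
    (hs : IsPreconnected s) {f : A → ℝ} (hf : ContinuousOn f s)
    (h0 : ∀ x ∈ s, (f x : UnitAddCircle) = 0) {x y : A} (hx : x ∈ s) (hy : y ∈ s) :
    f x = f y :=
  hs.constant_of_mapsTo (T := range ((↑) : ℤ → ℝ))
    Int.isClosedEmbedding_coe_real.isEmbedding.isDiscrete_range hf
    (fun z hz => by
      obtain ⟨n, hn⟩ := AddCircle.coe_eq_zero_iff (1 : ℝ) |>.1 (h0 z hz)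
      exact ⟨n, by simpa using hn⟩) hx hy

variable {M : Type*} [TopologicalSpace M]

/-- The first positive time at which the orbit of `p` meets `K`. -/
noncomputable def hittingTime (φ : Flow ℝ M) (K : Set M) (p : M) : ℝ :=
  sInf {t | 0 < t ∧ φ t p ∈ K}

/-- Orbits starting near `q` meet `K` exactly once in every sufficiently short time interval
around `0`. -/
def CrossedOnceNear (φ : Flow ℝ M) (K : Set M) (q : M) : Prop :=
  ∃ ε₀ > 0, ∀ ε, 0 < ε → ε ≤ ε₀ → ∀ᶠ p in 𝓝 q, ∃! t : ℝ, t ∈ Icc (-ε) ε ∧ φ t p ∈ K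

/-- The time elapsed since the last crossing of `K`, as a fraction of the time between the last and
the next crossing of `K`. -/
noncomputable def phase (φ : Flow ℝ M) (K : Set M) (p : M) : UnitAddCircle :=
  open Classical in
  if p ∈ K then 0 else
    ((hittingTime φ.reverse K p / (hittingTime φ.reverse K p + hittingTime φ K p) : ℝ) :
      UnitAddCircle)

variable {φ : Flow ℝ M} {K : Set M} {p q : M}

theorem CrossedOnceNear.reverse (h : CrossedOnceNear φ K q) : CrossedOnceNear φ.reverse K q := by
  obtain ⟨ε₀, h0, h⟩ := h
  refine ⟨ε₀, h0, fun ε hε hle => ?_⟩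
  filter_upwards [h ε hε hle] with p hp
  obtain ⟨t, ⟨ht, htK⟩, hu⟩ := hp
  refine ⟨-t, ⟨⟨by linarith [ht.2], by linarith [ht.1]⟩, ?_⟩, fun t' ⟨ht', htK'⟩ => ?_⟩
  · simpa [Flow.reverse_apply] using htK
  · rw [← hu (-t') ⟨⟨by linarith [ht'.2], by linarith [ht'.1]⟩, htK'⟩, neg_neg]

theorem bddBelow_hits (φ : Flow ℝ M) (K : Set M) (p : M) : BddBelow {t | 0 < t ∧ φ t p ∈ K} :=
  ⟨0, fun _ ht => ht.1.le⟩

theorem hittingTime_nonneg (φ : Flow ℝ M) (K : Set M) (p : M) : 0 ≤ hittingTime φ K p :=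
  Real.sInf_nonneg fun _ ht => ht.1.le

theorem hittingTime_le {t : ℝ} (ht : 0 < t) (hK : φ t p ∈ K) : hittingTime φ K p ≤ t :=
  csInf_le (bddBelow_hits φ K p) ⟨ht, hK⟩

theorem hittingTime_eq {t : ℝ} (ht : 0 < t) (hK : φ t p ∈ K)
    (hn : ∀ t', 0 < t' → t' < t → φ t' p ∉ K) : hittingTime φ K p = t :=
  IsLeast.csInf_eq ⟨⟨ht, hK⟩, fun t' ht' => not_lt.1 fun hlt => hn t' ht'.1 hlt ht'.2⟩

theorem le_hittingTime (hits : ∃ t, 0 < t ∧ φ t p ∈ K) {c : ℝ}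
    (hn : ∀ t, 0 < t → t < c → φ t p ∉ K) : c ≤ hittingTime φ K p :=
  le_csInf hits fun t ht => not_lt.1 fun hlt => hn t ht.1 hlt ht.2

theorem continuous_orbit (φ : Flow ℝ M) (p : M) : Continuous fun t : ℝ => φ t p :=
  φ.continuous continuous_id continuous_const

theorem notMem_of_lt_hittingTime {t : ℝ} (ht : 0 < t) (hlt : t < hittingTime φ K p) :
    φ t p ∉ K :=
  fun h => absurd (hittingTime_le ht h) (not_le.2 hlt)

/-- Hits cannot accumulate at time `0`, even when `p` lies on `K`, so the set of positive hitting
times is closed and attains its infimum. -/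
theorem hittingTime_mem (hK : IsClosed K) (hits : ∃ t, 0 < t ∧ φ t p ∈ K)
    (hp : p ∈ K → CrossedOnceNear φ K p) :
    0 < hittingTime φ K p ∧ φ (hittingTime φ K p) p ∈ K := by
  obtain ⟨ε, hε, hn⟩ : ∃ ε > 0, ∀ t, 0 < t → t < ε → φ t p ∉ K := by
    by_cases hpK : p ∈ K
    · obtain ⟨ε₀, h0, h⟩ := hp hpK
      refine ⟨ε₀, h0, fun t ht hlt htK => ht.ne ?_⟩
      exact (h ε₀ h0 le_rfl).self_of_nhds.unique
        ⟨⟨by linarith, h0.le⟩, by simpa using hpK⟩ ⟨⟨by linarith, hlt.le⟩, htK⟩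
    · have : ∀ᶠ t in 𝓝 (0 : ℝ), φ t p ∈ Kᶜ :=
        (continuous_orbit φ p).continuousAt.preimage_mem_nhds
          (hK.isOpen_compl.mem_nhds (by simpa using hpK))
      obtain ⟨ε, hε, hb⟩ := Metric.eventually_nhds_iff.1 this
      exact ⟨ε, hε, fun t ht hlt => hb (by rw [Real.dist_eq, sub_zero, abs_of_pos ht]; exact hlt)⟩
  have hset : {t | 0 < t ∧ φ t p ∈ K} = Ici ε ∩ (fun t => φ t p) ⁻¹' K := by
    ext t
    exact ⟨fun ht => ⟨not_lt.1 fun hlt => hn t ht.1 hlt ht.2, ht.2⟩,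
      fun ht => ⟨hε.trans_le ht.1, ht.2⟩⟩
  have hcl : IsClosed {t | 0 < t ∧ φ t p ∈ K} := by
    rw [hset]
    exact isClosed_Ici.inter (hK.preimage (continuous_orbit φ p))
  exact hcl.csInf_mem hits (bddBelow_hits φ K p)

/-- The crossing at the first hit persists, which bounds the hitting time above; the compact orbit
segment before it stays off `K` under perturbation, which bounds it below. The latter needs `q ∉ K`.
-/
theorem continuousAt_hittingTime (hK : IsClosed K) (hits : ∀ p, ∃ t, 0 < t ∧ φ t p ∈ K)
    (hq : q ∉ K) (hcross : CrossedOnceNear φ K (φ (hittingTime φ K q) q)) :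
    ContinuousAt (hittingTime φ K) q := by
  obtain ⟨hT, -⟩ := hittingTime_mem hK (hits q) (fun h => absurd h hq)
  set T := hittingTime φ K q with hTdef
  obtain ⟨ε₀, h0, hc⟩ := hcross
  rw [ContinuousAt, Metric.tendsto_nhds]
  intro δ hδ
  obtain ⟨ε, hε, hεδ⟩ := exists_between (lt_min (lt_min hδ h0) hT)
  have hεδ' : ε < δ := hεδ.trans_le ((min_le_left _ _).trans (min_le_left _ _))
  have hε0 : ε ≤ ε₀ := hεδ.le.trans ((min_le_left _ _).trans (min_le_right _ _))
  have hεT : ε < T := hεδ.trans_le (min_le_right _ _)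
  have h1 := (φ.continuous_toFun T).continuousAt.eventually (hc ε hε hε0)
  have h2 : ∀ᶠ p in 𝓝 q, ∀ t ∈ Icc 0 (T - ε), φ t p ∈ Kᶜ := by
    refine isCompact_Icc.eventually_forall_of_forall_eventually fun t ht => ?_
    have : Continuous (fun z : M × ℝ => φ z.2 z.1) := φ.continuous continuous_snd continuous_fst
    refine this.continuousAt.preimage_mem_nhds (hK.isOpen_compl.mem_nhds ?_)
    rcases ht.1.eq_or_lt with h | h
    · simpa [← h] using hq
    · exact notMem_of_lt_hittingTime h (by linarith [ht.2])
  filter_upwards [h1, h2] with p hp1 hp2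
  obtain ⟨t, ⟨ht, htK⟩, -⟩ := hp1
  have hu : hittingTime φ K p ≤ T + ε := by
    have h3 : φ (t + T) p ∈ K := by rw [φ.map_add]; exact htK
    refine (hittingTime_le (by linarith [ht.1]) h3).trans (by linarith [ht.2])
  have hl : T - ε ≤ hittingTime φ K p :=
    le_hittingTime (hits p) fun t ht hlt => hp2 t ⟨ht.le, hlt.le⟩
  rw [Real.dist_eq, abs_lt]
  constructor <;> linarith

theorem norm_coe_div_le {x y c ε : ℝ} (hx : 0 ≤ x) (hxε : x ≤ ε) (hc : 0 < c) (hy : c ≤ y) :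
    ‖((x / (x + y) : ℝ) : UnitAddCircle)‖ ≤ ε / c := by
  refine (QuotientAddGroup.norm_mk_le_norm (S := AddSubgroup.zmultiples (1 : ℝ))).trans ?_
  have hy0 : 0 ≤ y := hc.le.trans hy
  rw [Real.norm_of_nonneg (by positivity)]
  gcongr
  · exact hx.trans hxε
  · exact hy.trans (le_add_of_nonneg_left hx)

theorem coe_div_eq_neg {x y : ℝ} (h : 0 < x + y) :
    ((x / (x + y) : ℝ) : UnitAddCircle) = -((y / (y + x) : ℝ) : UnitAddCircle) := by
  rw [eq_neg_iff_add_eq_zero, ← AddCircle.coe_add, add_comm y x, ← add_div, div_self h.ne']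
  exact AddCircle.coe_period 1

/-- Near `K` one of the forward and backward hitting times is at most `ε` and the other at least
`ε₀`. The quotient is then within `ε / ε₀` of `0` or `1`, which agree in the circle. -/
theorem continuousAt_phase_of_mem (hits : ∀ p, ∃ t, 0 < t ∧ φ t p ∈ K)
    (hits' : ∀ p, ∃ t, 0 < t ∧ φ.reverse t p ∈ K) (hq : q ∈ K)
    (hcross : CrossedOnceNear φ K q) : ContinuousAt (phase φ K) q := by
  have hθq : phase φ K q = 0 := if_pos hq
  obtain ⟨ε₀, h0, hc⟩ := hcross
  rw [ContinuousAt, hθq, tendsto_zero_iff_norm_tendsto_zero, Metric.tendsto_nhds]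
  intro δ hδ
  have hδε : 0 < δ * ε₀ := by positivity
  obtain ⟨ε, hε, hlt⟩ := exists_between (lt_min hδε h0)
  have hε0 : ε ≤ ε₀ := hlt.le.trans (min_le_right _ _)
  have hεδ : ε / ε₀ < δ := by
    rw [div_lt_iff₀ h0]
    exact hlt.trans_le (min_le_left _ _)
  filter_upwards [hc ε hε hε0, hc ε₀ h0 le_rfl] with p hp hp0
  rw [Real.dist_eq, sub_zero, abs_of_nonneg (norm_nonneg _)]
  refine lt_of_le_of_lt ?_ hεδ
  by_cases hpK : p ∈ K
  · simp only [phase, if_pos hpK, norm_zero]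
    positivity
  simp only [phase, if_neg hpK]
  obtain ⟨t, ⟨ht, htK⟩, -⟩ := hp
  have ht0 : t ≠ 0 := by
    rintro rfl
    exact hpK (by simpa using htK)
  have huniq : ∀ t', t' ∈ Icc (-ε₀) ε₀ → φ t' p ∈ K → t' = t := fun t' ht' hK' =>
    hp0.unique ⟨ht', hK'⟩ ⟨⟨by linarith [ht.1], by linarith [ht.2]⟩, htK⟩
  rcases ht0.lt_or_gt with hneg | hpos
  · have h1 : hittingTime φ.reverse K p ≤ ε :=
      (hittingTime_le (neg_pos.2 hneg) (by simpa [Flow.reverse_apply] using htK)).trans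
        (by linarith [ht.1])
    have h2 : ε₀ ≤ hittingTime φ K p := le_hittingTime (hits p) fun t' ht' hlt' hK' => by
      linarith [huniq t' ⟨by linarith, hlt'.le⟩ hK']
    exact norm_coe_div_le (hittingTime_nonneg _ _ _) h1 h0 h2
  · have h1 : hittingTime φ K p ≤ ε := (hittingTime_le hpos htK).trans ht.2
    have h2 : ε₀ ≤ hittingTime φ.reverse K p :=
      le_hittingTime (hits' p) fun t' ht' hlt' hK' => by
        linarith [huniq (-t') ⟨by linarith, by linarith⟩ hK']
    rw [coe_div_eq_neg (by linarith [hittingTime_nonneg φ K p]), norm_neg]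
    exact norm_coe_div_le (hittingTime_nonneg _ _ _) h1 h0 h2

theorem continuousAt_phase_of_notMem (hK : IsClosed K) (hits : ∀ p, ∃ t, 0 < t ∧ φ t p ∈ K)
    (hits' : ∀ p, ∃ t, 0 < t ∧ φ.reverse t p ∈ K) (hq : q ∉ K)
    (hcross : ∀ t, φ t q ∈ K → CrossedOnceNear φ K (φ t q)) : ContinuousAt (phase φ K) q := by
  have h1 := hittingTime_mem hK (hits q) fun h => absurd h hq
  have h2 := hittingTime_mem hK (hits' q) fun h => absurd h hq
  have hc1 : ContinuousAt (hittingTime φ K) q :=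
    continuousAt_hittingTime hK hits hq (hcross _ h1.2)
  have hc2 : ContinuousAt (hittingTime φ.reverse K) q :=
    continuousAt_hittingTime hK hits' hq (hcross _ h2.2).reverse
  have hc : ContinuousAt (fun p => ((hittingTime φ.reverse K p /
      (hittingTime φ.reverse K p + hittingTime φ K p) : ℝ) : UnitAddCircle)) q :=
    (AddCircle.continuous_mk' 1).continuousAt.comp
      (hc2.div (hc2.add hc1) (by linarith [h1.1, h2.1]))
  refine hc.congr ?_
  filter_upwards [hK.isOpen_compl.mem_nhds hq] with p hp
  exact (if_neg hp).symm

/-- Between two consecutive crossings, the phase grows linearly from `0` to `1`. -/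
theorem phase_between {T t : ℝ} (hp : p ∈ K) (hT : 0 < T) (hTK : φ T p ∈ K)
    (hn : ∀ t, 0 < t → t < T → φ t p ∉ K) (ht : t ∈ Icc 0 T) :
    phase φ K (φ t p) = ((t / T : ℝ) : UnitAddCircle) := by
  rcases ht.1.eq_or_lt with rfl | h0
  · simp [phase, hp]
  rcases ht.2.eq_or_lt with rfl | h1
  · rw [phase, if_pos hTK, div_self hT.ne']
    exact (AddCircle.coe_period 1).symm
  have hf : hittingTime φ K (φ t p) = T - t := by
    refine hittingTime_eq (by linarith) (by rw [← φ.map_add, sub_add_cancel]; exact hTK)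
      fun t' h2 h3 => ?_
    rw [← φ.map_add]
    exact hn _ (by linarith) (by linarith)
  have hb : hittingTime φ.reverse K (φ t p) = t := by
    refine hittingTime_eq h0 ?_ fun t' h2 h3 => ?_
    · rw [Flow.reverse_apply, ← φ.map_add, neg_add_cancel, φ.map_zero_apply]
      exact hp
    · rw [Flow.reverse_apply, ← φ.map_add]
      exact hn _ (by linarith) (by linarith)
  rw [phase, if_neg (hn t h0 h1), hf, hb, add_sub_cancel]

/-- Real lifts of the phase along an orbit are unbounded. -/
theorem not_bounded_lift_phase (hK : IsClosed K) (hits : ∀ p, ∃ t, 0 < t ∧ φ t p ∈ K)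
    (hcross : ∀ t, φ t p ∈ K → CrossedOnceNear φ K (φ t p)) {l : ℝ → ℝ} (hl : Continuous l)
    (hlift : ∀ t, (l t : UnitAddCircle) = phase φ K (φ t p)) (C : ℝ) : ∃ t, C < l t := by
  obtain ⟨s₀, -, hs₀⟩ := hits p
  have hstep : ∀ n : ℕ, ∃ s, φ s p ∈ K ∧ l s = l s₀ + n := by
    intro n
    induction n with
    | zero => exact ⟨s₀, hs₀, by simp⟩
    | succ n ih =>
      obtain ⟨s, hs, hls⟩ := ih
      obtain ⟨hT, hTK⟩ := hittingTime_mem hK (hits (φ s p)) fun _ => hcross s hs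
      set T := hittingTime φ K (φ s p) with hTdef
      refine ⟨T + s, by rw [φ.map_add]; exact hTK, ?_⟩
      -- The difference between the lift and `t / T` is integer-valued on `[0, T]`, hence constant,
      -- so the lift gains exactly `1`.
      have key : l (T + s) - T / T = l (0 + s) - 0 / T := by
        refine eq_of_coe_unitAddCircle_eq_zero (s := Icc 0 T) (f := fun t => l (t + s) - t / T)
          isPreconnected_Icc (by fun_prop) (fun t ht => ?_) (right_mem_Icc.2 hT.le)
          (left_mem_Icc.2 hT.le)
        rw [AddCircle.coe_sub, hlift, φ.map_add, phase_between hs hT hTK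
          (fun t h h' => notMem_of_lt_hittingTime h h') ht, sub_self]
      rw [div_self hT.ne', zero_div, zero_add, sub_zero] at key
      push_cast
      linarith
  obtain ⟨n, hn⟩ := exists_nat_gt (C - l s₀)
  obtain ⟨s, -, hs⟩ := hstep n
  exact ⟨s, by linarith⟩

end Phase

/-! ### Periods of circle-valued maps on the torus -/

section Periods

/-- The covering map of the torus by the plane. -/
def toTorus (x : ℝ × ℝ) : Torus := ((x.1 : UnitAddCircle), (x.2 : UnitAddCircle))

theorem continuous_toTorus : Continuous toTorus :=
  ((AddCircle.continuous_mk' 1).comp continuous_fst).prodMk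
    ((AddCircle.continuous_mk' 1).comp continuous_snd)

theorem toTorus_add_left (x : ℝ × ℝ) : toTorus (x + (1, 0)) = toTorus x := by
  simp [toTorus]

theorem toTorus_add_right (x : ℝ × ℝ) : toTorus (x + (0, 1)) = toTorus x := by
  simp [toTorus]

/-- The circle-valued map `u` on the torus represents the cohomology class `(m, n)`. -/
def HasPeriods (u : Torus → UnitAddCircle) (m n : ℝ) : Prop :=
  ∃ l : ℝ × ℝ → ℝ, Continuous l ∧ (∀ x, (l x : UnitAddCircle) = u (toTorus x)) ∧
    (∀ x, l (x + (1, 0)) = l x + m) ∧ ∀ x, l (x + (0, 1)) = l x + n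

/-- One lift over the simply connected space `ℝ × ℝ²` serves all `r` at once. Its increment under a
deck translation is locally constant, so the periods do not depend on `r`. -/
theorem exists_hasPeriods_family (H : C(ℝ × Torus, UnitAddCircle)) :
    ∃ m n : ℝ, ∀ r, HasPeriods (fun x => H (r, x)) m n := by
  let W : C(ℝ × ℝ × ℝ, UnitAddCircle) := ⟨fun z => H (z.1, toTorus z.2), by
    have := continuous_toTorus
    fun_prop⟩
  obtain ⟨e, he⟩ := QuotientAddGroup.mk_surjective (W 0)
  obtain ⟨L, ⟨-, hL⟩, -⟩ := (AddCircle.isCoveringMap_coe (1 : ℝ)).existsUnique_continuousMap_lifts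
    W 0 e he
  have hL' : ∀ z, (L z : UnitAddCircle) = H (z.1, toTorus z.2) := fun z => congrFun hL z
  have hconst : ∀ c : ℝ × ℝ, (∀ x, toTorus (x + c) = toTorus x) →
      ∀ z : ℝ × ℝ × ℝ, L (z.1, z.2 + c) = L z + (L (0, 0 + c) - L 0) := by
    intro c hc z
    have := eq_of_coe_unitAddCircle_eq_zero (s := univ)
      (f := fun z : ℝ × ℝ × ℝ => L (z.1, z.2 + c) - L z) isPreconnected_univ (by fun_prop)
      (fun z _ => by rw [AddCircle.coe_sub, hL', hL', hc, sub_self]) (mem_univ z) (mem_univ 0)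
    have h0 : L ((0 : ℝ × ℝ × ℝ).1, (0 : ℝ × ℝ × ℝ).2 + c) = L (0, 0 + c) := rfl
    simp only [h0] at this
    linarith
  refine ⟨_, _, fun r => ⟨fun x => L (r, x), by fun_prop, fun x => hL' _,
    fun x => hconst _ toTorus_add_left (r, x), fun x => hconst _ toTorus_add_right (r, x)⟩⟩

theorem HasPeriods.unique {u : Torus → UnitAddCircle} {m n m' n' : ℝ} (h : HasPeriods u m n)
    (h' : HasPeriods u m' n') : m = m' ∧ n = n' := by
  obtain ⟨l, hl, hlu, h1, h2⟩ := h
  obtain ⟨l', hl', hlu', h1', h2'⟩ := h'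
  have key : ∀ x, l x - l' x = l 0 - l' 0 := fun x =>
    eq_of_coe_unitAddCircle_eq_zero (s := univ) (f := fun x => l x - l' x) isPreconnected_univ
      (by fun_prop) (fun x _ => by rw [AddCircle.coe_sub, hlu, hlu', sub_self]) (mem_univ x)
      (mem_univ 0)
  have k1 := key (0 + (1, 0))
  have k2 := key (0 + (0, 1))
  rw [h1, h1'] at k1
  rw [h2, h2'] at k2
  exact ⟨by linarith, by linarith⟩

theorem HasPeriods.of_homotopic {u u' : C(Torus, UnitAddCircle)} {m n : ℝ} (h : HasPeriods u m n)
    (hh : u.Homotopic u') : HasPeriods u' m n := by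
  obtain ⟨H⟩ := hh
  obtain ⟨m', n', hmn⟩ := exists_hasPeriods_family
    ⟨fun z : ℝ × Torus => H (projIcc 0 1 zero_le_one z.1, z.2), by fun_prop⟩
  have h0 : HasPeriods u m' n' := by simpa using hmn 0
  have h1 : HasPeriods u' m' n' := by simpa using hmn 1
  obtain ⟨rfl, rfl⟩ := h.unique h0
  exact h1

theorem exists_hasPeriods (u : C(Torus, UnitAddCircle)) : ∃ m n : ℝ, HasPeriods u m n := by
  obtain ⟨m, n, h⟩ := exists_hasPeriods_family ⟨fun z : ℝ × Torus => u z.2, by fun_prop⟩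
  exact ⟨m, n, h 0⟩

/-- A function on the plane with constant periods `(m, n)` is bounded along lines in the kernel of
`(m, n)`. -/
theorem exists_bound_of_periods {l : ℝ × ℝ → ℝ} {m n : ℝ} (hl : Continuous l)
    (h1 : ∀ x, l (x + (1, 0)) = l x + m) (h2 : ∀ x, l (x + (0, 1)) = l x + n) {v : ℝ × ℝ}
    (hv : m * v.1 + n * v.2 = 0) : ∃ C, ∀ t : ℝ, l (t • v) ≤ C := by
  -- Removing the linear part leaves a doubly periodic function, bounded by its values on the unit
  -- square; the linear part vanishes on the line spanned by `v`.
  let g : ℝ × ℝ → ℝ := fun x => l x - (m * x.1 + n * x.2)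
  have hg : Continuous g := by fun_prop
  have hp1 : ∀ b, Periodic (fun a => g (a, b)) 1 := fun b a => by
    have := h1 (a, b)
    simp only [Prod.mk_add_mk, add_zero] at this
    simp only [g, this]
    ring
  have hp2 : ∀ a, Periodic (fun b => g (a, b)) 1 := fun a b => by
    have := h2 (a, b)
    simp only [Prod.mk_add_mk, add_zero] at this
    simp only [g, this]
    ring
  obtain ⟨C, hC⟩ := ((isCompact_Icc (a := (0 : ℝ)) (b := 1)).prod
    (isCompact_Icc (a := (0 : ℝ)) (b := 1))).bddAbove_image hg.continuousOn
  refine ⟨C, fun t => ?_⟩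
  obtain ⟨a, ha, hta⟩ := (hp1 (t * v.2)).exists_mem_Ico₀ one_pos (t * v.1)
  obtain ⟨b, hb, htb⟩ := (hp2 a).exists_mem_Ico₀ one_pos (t * v.2)
  have h3 : l (t • v) = g (t * v.1, t * v.2) := by
    have : m * (t * v.1) + n * (t * v.2) = 0 := by linear_combination t * hv
    simp only [g, this, sub_zero]
    rfl
  have h4 : g (t * v.1, t * v.2) = g (a, b) := hta.trans htb
  rw [h3, h4]
  exact hC ⟨(a, b), ⟨Ico_subset_Icc_self ha, Ico_subset_Icc_self hb⟩, rfl⟩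

end Periods

/-! ### A torus whose direction is killed by the phase class -/

section Tori

variable {M : Type*} [TopologicalSpace M] {φ : Flow ℝ M} {a b : ℝ}

/-- On a connected family of invariant tori whose directions cover the projective line, a
circle-valued map has a bounded real lift along some orbit. -/
theorem InvariantTorusFamily.exists_bounded_lift (F : InvariantTorusFamily φ a b)
    (hF : F.CoversAllDirections) {θ : M → UnitAddCircle}
    (hθ : ∀ s ∈ Ioo a b, ∀ p ∈ F.torus s, ContinuousAt θ p) :
    ∃ s ∈ Ioo a b, ∃ p ∈ F.torus s, ∃ l : ℝ → ℝ, Continuous l ∧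
      (∀ t, (l t : UnitAddCircle) = θ (φ t p)) ∧ ∃ C, ∀ t, l t ≤ C := by
  have hc : ContinuousOn (fun z : ℝ × Torus => θ (F.param z.1 z.2))
      (Ioo a b ×ˢ (univ : Set Torus)) := fun z hz =>
    ContinuousAt.comp_continuousWithinAt (hθ z.1 hz.1 _ ⟨z.2, rfl⟩) (F.continuousOn_param z hz)
  have hcomp : ∀ {A : Type} [TopologicalSpace A] (σ : A → ℝ) (τ : A → Torus), Continuous σ →
      Continuous τ → (∀ x, σ x ∈ Ioo a b) → Continuous fun x => θ (F.param (σ x) (τ x)) :=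
    fun σ τ hσ hτ hab => hc.comp_continuous (hσ.prodMk hτ) fun x => ⟨hab x, mem_univ _⟩
  -- Any direction will do: this only supplies a base torus.
  obtain ⟨s₀, hs₀, -⟩ := hF (Projectivization.mk ℝ ((1, 0) : ℝ × ℝ) (by simp))
  let u (s : Ioo a b) : C(Torus, UnitAddCircle) :=
    ⟨fun x => θ (F.param s x), hcomp _ _ continuous_const continuous_id fun _ => s.2⟩
  obtain ⟨m, n, hmn⟩ := exists_hasPeriods (u ⟨s₀, hs₀⟩)
  obtain ⟨w, hw, hmw⟩ : ∃ w : ℝ × ℝ, w ≠ 0 ∧ m * w.1 + n * w.2 = 0 := by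
    by_cases h : (-n, m) = (0 : ℝ × ℝ)
    · have h' : n = 0 ∧ m = 0 := by simpa using h
      exact ⟨(1, 0), by simp, by simp [h'.2]⟩
    · exact ⟨(-n, m), h, by ring⟩
  obtain ⟨s, hs, hv, hvw⟩ := hF (Projectivization.mk ℝ w hw)
  have hmv : m * (F.velocity s).1 + n * (F.velocity s).2 = 0 := by
    obtain ⟨c, hc⟩ := (Projectivization.mk_eq_mk_iff' ℝ _ _ hv hw).1 hvw
    rw [← hc]
    simp only [Prod.smul_fst, Prod.smul_snd, smul_eq_mul]
    linear_combination c * hmw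
  obtain ⟨h, hh, hconj⟩ := F.conj_linear s hs
  have hom₁ : (u ⟨s₀, hs₀⟩).Homotopic (u ⟨s, hs⟩) := by
    refine ⟨⟨⟨fun z => θ (F.param (AffineMap.lineMap s₀ s (z.1 : ℝ)) z.2), ?_⟩, ?_, ?_⟩⟩
    · refine hcomp _ _ (AffineMap.lineMap_continuous.comp (by fun_prop)) continuous_snd fun z => ?_
      exact (convex_Ioo a b).lineMap_mem hs₀ hs z.1.2
    · intro x
      simp [u]
    · intro x
      simp [u]
  -- As `h` is homotopic to the identity, passing to the linearizing coordinates keeps the periods.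
  have hom₂ : (u ⟨s, hs⟩).Homotopic ((u ⟨s, hs⟩).comp (h : C(Torus, Torus))) := by
    simpa using (ContinuousMap.Homotopic.refl (u ⟨s, hs⟩)).comp hh.symm
  obtain ⟨l, hl, hlu, h1, h2⟩ := (hmn.of_homotopic hom₁).of_homotopic hom₂
  obtain ⟨C, hC⟩ := exists_bound_of_periods hl h1 h2 hmv
  refine ⟨s, hs, F.param s (h (toTorus 0)), ⟨_, rfl⟩, fun t => l (t • F.velocity s),
    by fun_prop, fun t => ?_, C, hC⟩
  rw [hlu, hconj]
  have : toTorus (t • F.velocity s) = linearMotion (F.velocity s) t (toTorus 0) := by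
    simp [toTorus, linearMotion]
  rw [this]
  rfl

end Tori

end BirkhoffTori

/-! ### The contradiction -/

theorem proposition2p7
    {M : Type*} [TopologicalSpace M] [T2Space M]
    [ChartedSpace (EuclideanSpace ℝ (Fin 3)) M] [IsManifold (𝓡 3) ∞ M]
    (X : (p : M) → TangentSpace (𝓡 3) p)
    (hX : BirkhoffTori.IsC1VectorField X) (hX0 : ∀ p : M, X p ≠ 0)
    (φ : Flow ℝ M) (hφ : BirkhoffTori.IsFlowOf φ X)
    (a b : ℝ) (F : BirkhoffTori.InvariantTorusFamily φ a b)
    (hF : F.CoversAllDirections)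
    {S : Type*} [TopologicalSpace S] [T2Space S] [CompactSpace S]
    [ChartedSpace (EuclideanHalfSpace 2) S] [IsManifold (𝓡∂ 2) ∞ S]
    (ι : S → M) (hι : BirkhoffTori.IsBirkhoffSection X φ ι) :
    ((ι '' (𝓡∂ 2).boundary S) ∩ ⋃ s ∈ Ioo a b, F.torus s).Nonempty := by
  by_contra hempty
  have hdisj : ∀ s ∈ Ioo a b, ∀ p ∈ F.torus s, p ∉ ι '' (𝓡∂ 2).boundary S :=
    fun s hs p hp hb => hempty ⟨p, hb, mem_iUnion₂.2 ⟨s, hs, hp⟩⟩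
  -- The boundary image is a union of full orbits, so its complement is flow-invariant, and every
  -- crossing on an orbit in a torus is at an interior point of `S`.
  have hinv : ∀ (t : ℝ) (p : M), p ∉ ι '' (𝓡∂ 2).boundary S →
      φ t p ∉ ι '' (𝓡∂ 2).boundary S := by
    intro t p hp hb
    obtain ⟨P, ⟨q, -, rfl⟩, ⟨r, hr⟩, hP⟩ := hι.boundary_orbits _ hb
    refine hp (hP ⟨-t + r, ?_⟩)
    have hr' : φ r q = φ t p := hr
    change φ (-t + r) q = p
    rw [φ.map_add, hr', ← φ.map_add, neg_add_cancel, φ.map_zero_apply]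
  have hK : IsClosed (range ι) := (isCompact_range hι.contMDiff.continuous).isClosed
  have hcross : ∀ p ∉ ι '' (𝓡∂ 2).boundary S, ∀ t, φ t p ∈ range ι →
      BirkhoffTori.CrossedOnceNear φ (range ι) (φ t p) := by
    rintro p hp t ⟨y, hy⟩
    rw [← hy]
    refine hι.eventually_existsUnique_crossing hX hφ fun hb => hinv t p hp ?_
    exact ⟨y, hb, hy⟩
  have hits : ∀ p, ∃ t, 0 < t ∧ φ t p ∈ range ι := fun p => (hι.hits p).2
  have hits' : ∀ p, ∃ t, 0 < t ∧ φ.reverse t p ∈ range ι := fun p => by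
    obtain ⟨t, ht, htr⟩ := (hι.hits p).1
    exact ⟨-t, neg_pos.2 ht, by simpa [Flow.reverse_apply] using htr⟩
  obtain ⟨s, hs, p, hp, l, hl, hlift, C, hC⟩ := F.exists_bounded_lift hF
    (θ := BirkhoffTori.phase φ (range ι)) (fun s hs q hq => by
      have hc := hcross q (hdisj s hs q hq)
      by_cases hqK : q ∈ range ι
      · exact BirkhoffTori.continuousAt_phase_of_mem hits hits' hqK
          (by simpa using hc 0 (by simpa using hqK))
      · exact BirkhoffTori.continuousAt_phase_of_notMem hK hits hits' hqK hc)
  obtain ⟨t, ht⟩ := BirkhoffTori.not_bounded_lift_phase hK hits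
    (hcross p (hdisj s hs p hp)) hl hlift C
  exact absurd (hC t) (not_le.2 ht)
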